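/- Let $F(y,p)\in\mathbb{C}[y,p]$ be a non-constant polynomial having no non-constant factor in $\mathbb{C}[y]$ and no non-constant factor in $\mathbb{C}[p]$. Then for every $(x_0,y_0)\in\mathbb{C}^2$ there exists an analytic (possibly ramified at $x_0$) solution $y(x)$ of $F(y,y')=0$ with $y(x_0)=y_0$, in the following sense. There are an integer $n\ge 1$, a real number $\rho>0$ and a Puiseux series $$y(x)=y_0+\sum_{i\ge 1}c_i\,(x-x_0)^{i/n},\qquad c_i\in\mathbb{C},$$ such that $F(y,y')=0$ holds as an identity of formal Puiseux series in $x-x_0$ (with $y'$ the termwise derivative); the power series $A(t)=y_0+\sum_{i\ge1}c_i t^i$ converges for $|t|<\rho$; for every open set $U\subseteq\{|x-x_0|<\rho^n\}$ and every holomorphic function $s$ on $U$ with $s(x)^n=x-x_0$, the function $y(x)=A(s(x))$ is holomorphic on $U$ and satisfies $F(y(x),y'(x))=0$ for all $x\in U$; and for every function $s$ with $s(x)^n=x-x_0$ near $x_0$ one has $A(s(x_0))=y_0$ and $A(s(x))\to y_0$ as $x\to x_0$. -/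

import Mathlib

open Filter Topology

namespace PuiseuxODE

/-- A Hahn series with rational exponents and complex coefficients is a formal Puiseux series with
exponents in `(1/n)ℤ`, i.e. an element of `ℂ((x^{1/n}))`. (The support of a Hahn series is
well-ordered, so the exponents in `(1/n)ℤ` are automatically bounded below.) -/
def HasDenominator (φ : HahnSeries ℚ ℂ) (n : ℕ) : Prop :=
  0 < n ∧ ∀ q ∈ φ.support, ∃ j : ℤ, q = (j : ℚ) / n

/-- The termwise derivative: `∑ a_q x^q ↦ ∑ q a_q x^(q-1)`. -/
noncomputable def formalDeriv (φ : HahnSeries ℚ ℂ) : HahnSeries ℚ ℂ where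
  coeff q := ((q + 1 : ℚ) : ℂ) * φ.coeff (q + 1)
  isPWO_support' := by
    have h : ((fun q : ℚ => q - 1) '' φ.support).IsPWO :=
      φ.isPWO_support.image_of_monotone fun a b hab => sub_le_sub_right hab 1
    refine h.mono fun q hq => ⟨q + 1, ?_, by simp⟩
    exact right_ne_zero_of_mul hq

/-- `F(φ, φ') = 0` as an identity of formal series. The variables `y`, `p` of `F` are `X 0`, `X 1`. -/
def IsFormalSolution (F : MvPolynomial (Fin 2) ℂ) (φ : HahnSeries ℚ ℂ) : Prop :=
  MvPolynomial.aeval ![φ, formalDeriv φ] F = 0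

/-- With `φ = ∑_j a_j x^{j/n}`, the Laurent series `∑_j a_j t^j` (so `t = x^{1/n}`) converges
for `0 < |t| < ρ`. -/
def ConvergesOn (φ : HahnSeries ℚ ℂ) (n : ℕ) (ρ : ℝ) : Prop :=
  ∀ t : ℂ, 0 < ‖t‖ → ‖t‖ < ρ → Summable fun j : ℤ => φ.coeff ((j : ℚ) / n) * t ^ j

/-- The sum `∑_j a_j t^j` of `φ = ∑_j a_j x^{j/n}` at `t = x^{1/n}`. -/
noncomputable def puiseuxSum (φ : HahnSeries ℚ ℂ) (n : ℕ) (t : ℂ) : ℂ :=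
  ∑' j : ℤ, φ.coeff ((j : ℚ) / n) * t ^ j

/-- The formal series `φ` has no negative exponents and its constant term is `y₀`. -/
def HasInitialValue (φ : HahnSeries ℚ ℂ) (y₀ : ℂ) : Prop :=
  (∀ q : ℚ, q < 0 → φ.coeff q = 0) ∧ φ.coeff 0 = y₀

/-- `y` is a holomorphic solution of `F(y, y') = 0` on the (open) set `U`. -/
def IsSolutionOn (F : MvPolynomial (Fin 2) ℂ) (U : Set ℂ) (y : ℂ → ℂ) : Prop :=
  DifferentiableOn ℂ y U ∧ ∀ x ∈ U, MvPolynomial.eval ![y x, deriv y x] F = 0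

/-- `F` has no non-constant factor that is a polynomial in the single variable `X i`. -/
def NoFactorIn (F : MvPolynomial (Fin 2) ℂ) (i : Fin 2) : Prop :=
  ∀ g : Polynomial ℂ, Polynomial.aeval (MvPolynomial.X i : MvPolynomial (Fin 2) ℂ) g ∣ F → IsUnit g

end PuiseuxODE

open PuiseuxODE

/-! ### Polynomials with analytic coefficients: simple roots, shifts, multiplicities -/

namespace PuiseuxODE

open Polynomial

/-! If F(y₀, 0) = 0, the constant y₀ is a solution. Otherwise exchange the roles of x and y: with q
= dx/dy the equation reads F(y, 1/q) = 0. Let d be the degree of F in p, which is positive because F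
has no factor in ℂ[y]. After multiplication by q^d, the coefficient of q^d at y = y₀ is F(y₀, 0) ≠
0, so there is a finite root q = α over y₀. Newton–Puiseux (`exists_analytic_puiseux_root`) yields a
branch y = y₀ + t^m, q = Q(t) with Q analytic and not identically zero. Then dx = q dy = m t^(m-1)
Q(t) dt. Integrating and extracting an N-th root of the unit part (`exists_normalizing_coordinate`)
gives a coordinate s with t = T(s) and x - x₀ = s^N, so y = A(s) = y₀ + T(s)^m is analytic in s.

Newton–Puiseux itself is an induction on the multiplicity e of the root of the reduction. A shift
removes the term of degree e - 1. Rescaling along a Newton polygon edge then gives a reduction of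
degree e that is not a monomial and has no such term, hence is not c(X - α)^e, and the multiplicity
drops.

To pass to formal series, the equation in A and A'/(N s^(N-1)) is multiplied by a power of N s^(N-1)
(`exists_homogenization`). The result extends across s = 0 and goes to Taylor series, then to Hahn
series by s = x^(1/N). The homogenization is stated over all ℂ-algebras, so it serves both numbers
and series. -/

/-- The functions `ℂ → ℂ` that are analytic at `0`. -/
def analyticAtZero : Subring (ℂ → ℂ) where
  carrier := {f | AnalyticAt ℂ f 0}
  mul_mem' := fun ha hb => AnalyticAt.mul ha hb
  one_mem' := analyticAt_const
  add_mem' := fun ha hb => AnalyticAt.add ha hb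
  zero_mem' := analyticAt_const
  neg_mem' := fun ha => AnalyticAt.neg ha

/-- Evaluation at a point. -/
def evalAt (t : ℂ) : analyticAtZero →+* ℂ :=
  (Pi.evalRingHom (fun _ : ℂ => ℂ) t).comp analyticAtZero.subtype

@[simp] theorem evalAt_apply (t : ℂ) (f : analyticAtZero) : evalAt t f = f.1 t := rfl

/-- A simple root of the reduction at `t = 0` lifts to an analytic root. -/
theorem exists_analytic_root_of_simple (P : analyticAtZero[X])
    (h0 : (P.coeff 0).1 0 = 0) (h1 : (P.coeff 1).1 0 ≠ 0) :
    ∃ Q : analyticAtZero, Q.1 0 = 0 ∧ ∀ᶠ t in 𝓝 (0 : ℂ), P.eval₂ (evalAt t) (Q.1 t) = 0 := by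
  let f : ℂ × ℂ → ℂ := fun z => P.eval₂ (evalAt z.1) z.2
  have hf : AnalyticAt ℂ f (0, 0) := by
    have hf' : f = fun z => ∑ i ∈ Finset.range (P.natDegree + 1), (P.coeff i).1 z.1 * z.2 ^ i := by
      funext z
      simp [f, eval₂_eq_sum_range]
    rw [hf']
    refine Finset.analyticAt_fun_sum _ fun i _ => ?_
    have h : AnalyticAt ℂ (P.coeff i).1 ((0 : ℂ × ℂ)).1 := (P.coeff i).2
    exact (h.comp analyticAt_fst).mul (analyticAt_snd.pow i)
  have hc : ContDiffAt ℂ 1 f (0, 0) := hf.contDiffAt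
  have hd : fderiv ℂ f (0, 0) (0, 1) = (P.coeff 1).1 0 := by
    have e1 : HasDerivAt (fun q : ℂ => f (0, q)) (fderiv ℂ f (0, 0) (0, 1)) 0 := by
      have h2 : HasDerivAt (fun q : ℂ => ((0 : ℂ), q)) ((0 : ℂ), (1 : ℂ)) 0 :=
        (hasDerivAt_const _ _).prodMk (hasDerivAt_id _)
      exact HasFDerivAt.comp_hasDerivAt (0 : ℂ) hf.differentiableAt.hasFDerivAt h2
    have e2 : (fun q : ℂ => f (0, q)) = fun q => (P.map (evalAt 0)).eval q := by
      funext q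
      simp [f, eval_map]
    rw [e2] at e1
    rw [e1.unique ((P.map (evalAt 0)).hasDerivAt 0), ← coeff_zero_eq_eval_zero, coeff_derivative]
    simp
  have hi : (fderiv ℂ f (0, 0) ∘L .inr ℂ ℂ ℂ).IsInvertible := by
    refine ⟨ContinuousLinearEquiv.unitsEquivAut ℂ (Units.mk0 _ h1), ?_⟩
    ext
    simp [hd]
  refine ⟨⟨hc.implicitFunction one_ne_zero hi, ?_⟩, hc.implicitFunction_apply_self one_ne_zero hi, ?_⟩
  · have := hc.contDiffAt_implicitFunction one_ne_zero hi
    change AnalyticAt ℂ _ 0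
    -- The implicit function is used only as a C¹ function; complex differentiability near 0
    -- upgrades it to an analytic one.
    rw [Complex.analyticAt_iff_eventually_differentiableAt]
    filter_upwards [this.eventually (by simp)] with z hz using hz.differentiableAt one_ne_zero
  · have hf0 : f (0, 0) = 0 := by
      simp only [f]
      rw [← eval_map, ← coeff_zero_eq_eval_zero]
      simpa using h0
    filter_upwards [hc.eventually_apply_implicitFunction one_ne_zero hi] with t ht
    rw [hf0] at ht
    exact ht

theorem eval₂_taylor_evalAt (P : analyticAtZero[X]) (h : analyticAtZero) (t q : ℂ) :
    (taylor h P).eval₂ (evalAt t) q = P.eval₂ (evalAt t) (q + h.1 t) := by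
  rw [← eval_map, map_taylor, taylor_eval, eval_map, evalAt_apply]

/-- A shift by an analytic function removes the coefficient before the first one
that does not vanish at `0`. -/
theorem exists_taylor_coeff_eventually_zero (P : analyticAtZero[X]) (e : ℕ)
    (h0 : (P.coeff e).1 0 = 0) (h1 : (P.coeff (e + 1)).1 0 ≠ 0) :
    ∃ h : analyticAtZero, h.1 0 = 0 ∧
      (∀ i, ((taylor h P).coeff i).1 0 = (P.coeff i).1 0) ∧
      ∀ᶠ t in 𝓝 (0 : ℂ), ((taylor h P).coeff e).1 t = 0 := by
  obtain ⟨h, hh, hr⟩ := exists_analytic_root_of_simple (hasseDeriv e P)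
    (by rw [hasseDeriv_coeff]; simp [h0])
    (by
      rw [hasseDeriv_coeff, add_comm 1 e]
      simpa using ⟨by exact_mod_cast e.succ_ne_zero, h1⟩)
  refine ⟨h, hh, fun i => ?_, ?_⟩
  · have : (taylor h P).map (evalAt 0) = P.map (evalAt 0) := by
      rw [map_taylor, evalAt_apply, hh, taylor_zero]
    simpa only [coeff_map, evalAt_apply] using congrArg (fun p => p.coeff i) this
  · filter_upwards [hr] with t ht
    rw [taylor_coeff]
    change evalAt t _ = 0
    rw [← ht, ← eval₂_id, hom_eval₂]
    rfl

/-- A polynomial of degree `e` without term of degree `e - 1`, not a monomial, only has roots of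
multiplicity less than `e`. -/
theorem exists_root_of_small_multiplicity (p : ℂ[X]) (e : ℕ) (hdeg : p.natDegree = e + 1)
    (hsub : p.coeff e = 0) (i : ℕ) (hi : i ≤ e) (hpi : p.coeff i ≠ 0) :
    ∃ (α : ℂ) (k : ℕ), 1 ≤ k ∧ k ≤ e ∧ (∀ j < k, (taylor α p).coeff j = 0) ∧
      (taylor α p).coeff k ≠ 0 := by
  have hp : p ≠ 0 := by rintro rfl; simp at hpi
  obtain ⟨α, hα⟩ := Complex.exists_root (f := p) (natDegree_pos_iff_degree_pos.mp (by omega))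
  have ht : taylor α p ≠ 0 := by simpa using hp
  refine ⟨α, (taylor α p).natTrailingDegree, ?_, ?_, fun j hj =>
    coeff_eq_zero_of_lt_natTrailingDegree hj, trailingCoeff_nonzero_iff_nonzero.mpr ht⟩
  · rw [Nat.one_le_iff_ne_zero, Ne, natTrailingDegree_eq_zero, not_or, taylor_coeff_zero]
    exact ⟨ht, fun h => h hα⟩
  · by_contra! hlt
    have hle := natTrailingDegree_le_natDegree (taylor α p)
    rw [natDegree_taylor, hdeg] at hle
    -- A root of full multiplicity would give p = c(X - α)^(e+1).
    have hmon : taylor α p = monomial (e + 1) p.leadingCoeff := by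
      ext j
      rw [coeff_monomial]
      split_ifs with hj
      · rw [← hj, ← hdeg, coeff_taylor_natDegree]
      · rcases lt_or_gt_of_ne hj with h | h
        · exact coeff_eq_zero_of_natDegree_lt (by rw [natDegree_taylor]; omega)
        · exact coeff_eq_zero_of_lt_natTrailingDegree (by omega)
    have hback : p = C p.leadingCoeff * (X + C (-α)) ^ (e + 1) := by
      have := congrArg (taylor (-α)) hmon
      rwa [taylor_taylor, neg_add_cancel, taylor_zero, taylor_monomial] at this
    have hl : p.leadingCoeff ≠ 0 := leadingCoeff_ne_zero.mpr hp
    -- The coefficient of X^e is -(e + 1)αc, so its vanishing forces α = 0 and p would be a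
    -- monomial, against `hpi`.
    have hα0 : α = 0 := by
      rw [hback, coeff_C_mul, coeff_X_add_C_pow] at hsub
      have h2 : (e : ℂ) + 1 ≠ 0 := Nat.cast_add_one_ne_zero e
      simpa [hl, h2] using hsub
    rw [hback, hα0, neg_zero, C_0, add_zero, coeff_C_mul, coeff_X_pow, if_neg (by omega)] at hpi
    simp at hpi

end PuiseuxODE

/-! ### Newton polygon and the Newton–Puiseux theorem -/

namespace PuiseuxODE

open Polynomial

theorem tendsto_pow_zero {v : ℕ} (hv : 1 ≤ v) : Tendsto (fun t : ℂ => t ^ v) (𝓝 0) (𝓝 0) := by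
  simpa [zero_pow (by omega : v ≠ 0)] using (continuous_pow (M := ℂ) v).tendsto 0

theorem analyticAt_comp_pow {f : ℂ → ℂ} (hf : AnalyticAt ℂ f 0) {v : ℕ} (hv : 1 ≤ v) :
    AnalyticAt ℂ (fun t => f (t ^ v)) 0 := by
  have h : AnalyticAt ℂ f ((0 : ℂ) ^ v) := by rwa [zero_pow (by omega)]
  exact AnalyticAt.fun_comp h (analyticAt_id.pow v)

theorem exists_eventually_eq_pow_mul {f : ℂ → ℂ} (hf : AnalyticAt ℂ f 0)
    (h : ¬ ∀ᶠ t in 𝓝 (0 : ℂ), f t = 0) :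
    ∃ (k : ℕ) (b : ℂ → ℂ), AnalyticAt ℂ b 0 ∧ b 0 ≠ 0 ∧ ∀ᶠ t in 𝓝 (0 : ℂ), f t = t ^ k * b t := by
  simpa using hf.exists_eventuallyEq_pow_smul_nonzero_iff.mpr h

/-- Rescaling along an edge of the Newton polygon. -/
theorem exists_newton_rescaling (P : analyticAtZero[X]) (e : ℕ)
    (hlow : ∀ i ≤ e, (P.coeff i).1 0 = 0) (htop : (P.coeff (e + 1)).1 0 ≠ 0)
    (hsub : ∀ᶠ t in 𝓝 (0 : ℂ), (P.coeff e).1 t = 0)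
    (hne : ¬ ∀ᶠ t in 𝓝 (0 : ℂ), (P.coeff 0).1 t = 0) :
    ∃ (u v : ℕ) (R : analyticAtZero[X]), 1 ≤ v ∧
      (∀ᶠ t in 𝓝 (0 : ℂ), ∀ q : ℂ, P.eval₂ (evalAt (t ^ v)) (t ^ u * q) =
        t ^ (u * (e + 1)) * R.eval₂ (evalAt t) q) ∧
      (R.map (evalAt 0)).natDegree = e + 1 ∧ (R.coeff e).1 0 = 0 ∧
      ∃ i ≤ e, (R.coeff i).1 0 ≠ 0 := by
  classical
  choose! k b hb hb0 hkb using fun (i : ℕ) (h : ¬ ∀ᶠ t in 𝓝 (0 : ℂ), (P.coeff i).1 t = 0) =>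
    exists_eventually_eq_pow_mul (P.coeff i).2 h
  -- With k i the order of the i-th coefficient, i₀ minimizes the slope k i / (e + 1 - i). The edge
  -- joins i₀ to e + 1 and has slope u / v with u = k i₀, v = e + 1 - i₀.
  obtain ⟨i₀, hi₀, hmin⟩ := Finset.exists_min_image
    ((Finset.range (e + 1)).filter fun i => ¬ ∀ᶠ t in 𝓝 (0 : ℂ), (P.coeff i).1 t = 0)
    (fun i => (k i : ℚ) / ((e + 1 - i : ℕ) : ℚ)) ⟨0, Finset.mem_filter.mpr ⟨Finset.mem_range.mpr (by omega), hne⟩⟩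
  rw [Finset.mem_filter, Finset.mem_range] at hi₀
  obtain ⟨hi₀e, hi₀n⟩ := hi₀
  have hmin' : ∀ i ≤ e, (¬ ∀ᶠ t in 𝓝 (0 : ℂ), (P.coeff i).1 t = 0) →
      k i₀ * (e + 1 - i) ≤ k i * (e + 1 - i₀) := by
    intro i hi hn
    have h := hmin i (Finset.mem_filter.mpr ⟨Finset.mem_range.mpr (by omega), hn⟩)
    have p1 : 0 < ((e + 1 - i₀ : ℕ) : ℚ) := by exact_mod_cast (by omega)
    have p2 : 0 < ((e + 1 - i : ℕ) : ℚ) := by exact_mod_cast (by omega)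
    rw [div_le_div_iff₀ p1 p2] at h
    exact_mod_cast h
  -- Positivity of u is what kills the terms of degree above e + 1 at t = 0.
  have hu : 1 ≤ k i₀ := by
    by_contra! h
    have := (hkb i₀ hi₀n).self_of_nhds
    rw [hlow i₀ (by omega), (by omega : k i₀ = 0)] at this
    exact hb0 i₀ hi₀n (by simpa using this.symm)
  have hi₀e' : i₀ ≠ e := by
    rintro rfl
    exact hi₀n hsub
  generalize hu' : k i₀ = u at *
  obtain ⟨v, hv⟩ : ∃ v, v = e + 1 - i₀ := ⟨_, rfl⟩
  rw [← hv] at hmin'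
  have hv1 : 1 ≤ v := by omega
  -- Under t ↦ t^v, q ↦ t^u q, the i-th term acquires order v k i + u i. By minimality this is at
  -- least u (e + 1) for i ≤ e, with equality at i₀, so t^(u (e + 1)) divides every term.
  have key : ∀ i, ∃ c : analyticAtZero,
      (∀ᶠ t in 𝓝 (0 : ℂ), (P.coeff i).1 (t ^ v) * t ^ (u * i) = t ^ (u * (e + 1)) * c.1 t) ∧
      (e + 1 < i → c.1 0 = 0) ∧ (i = e + 1 → c.1 0 ≠ 0) ∧ (i = e → c.1 0 = 0) ∧
      (i = i₀ → c.1 0 ≠ 0) := by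
    intro i
    rcases lt_or_ge i (e + 1) with hi | hi
    · by_cases hz : ∀ᶠ t in 𝓝 (0 : ℂ), (P.coeff i).1 t = 0
      · refine ⟨0, ?_, by omega, by omega, fun _ => rfl, ?_⟩
        · filter_upwards [(tendsto_pow_zero hv1).eventually hz] with t ht
          simp [ht]
        · rintro rfl
          exact absurd hz hi₀n
      · have hle := hmin' i (by omega) hz
        obtain ⟨w, hw⟩ := Nat.exists_eq_add_of_le hle
        refine ⟨⟨fun t => t ^ w * b i (t ^ v),
          (analyticAt_id.pow w).mul (analyticAt_comp_pow (hb i hz) hv1)⟩, ?_, by omega, by omega,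
          ?_, ?_⟩
        · filter_upwards [(tendsto_pow_zero hv1).eventually (hkb i hz)] with t ht
          have e1 : v * k i + u * i = u * (e + 1) + w := by
            have : u * (e + 1) = u * (e + 1 - i) + u * i := by
              rw [← mul_add, Nat.sub_add_cancel (by omega)]
            rw [this, mul_comm v, hw]
            ring
          calc _ = t ^ (v * k i + u * i) * b i (t ^ v) := by rw [ht]; ring
            _ = _ := by rw [e1]; ring
        · rintro rfl
          exact absurd hsub hz
        · rintro rfl
          have : w = 0 := by
            rw [← hv, hu'] at hw
            omega
          subst this
          simpa [zero_pow (by omega : v ≠ 0)] using hb0 i hz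
    · obtain ⟨w, rfl⟩ := Nat.exists_eq_add_of_le hi
      refine ⟨⟨fun t => t ^ (u * w) * (P.coeff (e + 1 + w)).1 (t ^ v),
          (analyticAt_id.pow _).mul (analyticAt_comp_pow (P.coeff _).2 hv1)⟩, ?_, ?_, ?_,
          by omega, by omega⟩
      · refine Eventually.of_forall fun t => ?_
        ring
      · intro h
        have : u * w ≠ 0 := Nat.mul_ne_zero (by omega) (by omega)
        simp [zero_pow this]
      · intro h
        have : w = 0 := by omega
        subst this
        simpa [zero_pow (by omega : v ≠ 0)] using htop
  choose c hc hc1 hc2 hc3 hc4 using key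
  have hdeg : e + 1 ≤ P.natDegree := le_natDegree_of_ne_zero fun h => htop (by rw [h]; rfl)
  let R : analyticAtZero[X] := ∑ i ∈ Finset.range (P.natDegree + 1), monomial i (c i)
  have hR : ∀ i ≤ P.natDegree, R.coeff i = c i := by
    intro i hi
    simp only [R, finsetSum_coeff, coeff_monomial]
    rw [Finset.sum_ite_eq' , if_pos (Finset.mem_range.mpr (by omega))]
  have hR' : ∀ i, P.natDegree < i → R.coeff i = 0 := by
    intro i hi
    simp only [R, finsetSum_coeff, coeff_monomial]
    rw [Finset.sum_ite_eq', if_neg (by simp; omega)]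
  refine ⟨u, v, R, hv1, ?_, ?_, ?_, i₀, by omega, ?_⟩
  · have hall : ∀ᶠ t in 𝓝 (0 : ℂ), ∀ i ∈ Finset.range (P.natDegree + 1),
        (P.coeff i).1 (t ^ v) * t ^ (u * i) = t ^ (u * (e + 1)) * (c i).1 t :=
      (Finset.eventually_all _).mpr fun i _ => hc i
    filter_upwards [hall] with t ht q
    simp only [R, eval₂_finsetSum, eval₂_monomial]
    rw [eval₂_eq_sum_range, Finset.mul_sum]
    refine Finset.sum_congr rfl fun i hi => ?_
    rw [evalAt_apply, evalAt_apply, mul_pow, ← pow_mul, ← mul_assoc, ht i hi, mul_assoc]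
  · refine natDegree_eq_of_le_of_coeff_ne_zero ?_ ?_
    · rw [natDegree_le_iff_coeff_eq_zero]
      intro i hi
      rw [coeff_map]
      rcases le_or_gt i P.natDegree with h | h
      · rw [hR i h]
        exact hc1 i hi
      · rw [hR' i h, map_zero]
    · rw [coeff_map, hR _ hdeg]
      exact hc2 _ rfl
  · rw [hR e (by omega)]
    exact hc3 e rfl
  · rw [hR i₀ (by omega)]
    exact hc4 i₀ rfl

/-- **Newton–Puiseux theorem**, analytic form: a polynomial with coefficients analytic at `0` whose
reduction at `0` has `0` as a root of multiplicity `e ≥ 1` has a root analytic in `t ^ (1 / m)`. -/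
theorem exists_analytic_puiseux_root (e : ℕ) (he : 1 ≤ e) (P : analyticAtZero[X])
    (hlow : ∀ i < e, (P.coeff i).1 0 = 0) (htop : (P.coeff e).1 0 ≠ 0) :
    ∃ (m : ℕ) (Q : ℂ → ℂ), 1 ≤ m ∧ AnalyticAt ℂ Q 0 ∧
      ∀ᶠ t in 𝓝 (0 : ℂ), P.eval₂ (evalAt (t ^ m)) (Q t) = 0 := by
  induction e using Nat.strong_induction_on generalizing P with
  | _ e ih =>
  obtain ⟨e, rfl⟩ : ∃ e', e = e' + 1 := ⟨e - 1, by omega⟩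
  obtain ⟨h, hh0, hcoeff, hsub⟩ :=
    exists_taylor_coeff_eventually_zero P e (hlow e (by omega)) htop
  by_cases hz : ∀ᶠ t in 𝓝 (0 : ℂ), ((taylor h P).coeff 0).1 t = 0
  -- If the shifted polynomial has constant term zero near 0, the shift h is itself a root.
  · refine ⟨1, h.1, le_rfl, h.2, ?_⟩
    filter_upwards [hz] with t ht
    rw [pow_one, ← ht, taylor_coeff_zero]
    change _ = evalAt t _
    rw [← eval₂_id, hom_eval₂]
    rfl
  obtain ⟨u, v, R, hv, hPR, hdeg, hRe, i, hi, hRi⟩ := exists_newton_rescaling (taylor h P) e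
    (fun i hi => by rw [hcoeff, hlow i (by omega)]) (by rwa [hcoeff]) hsub hz
  obtain ⟨α, k, hk1, hke, hklow, hk⟩ := exists_root_of_small_multiplicity (R.map (evalAt 0)) e hdeg
    (by simpa using hRe) i hi (by simpa using hRi)
  let a : analyticAtZero := ⟨fun _ => α, analyticAt_const⟩
  have hred : ∀ j, ((taylor a R).coeff j).1 0 = (taylor α (R.map (evalAt 0))).coeff j := by
    intro j
    have : (taylor a R).map (evalAt 0) = taylor α (R.map (evalAt 0)) := map_taylor ..
    rw [← this, coeff_map, evalAt_apply]
  obtain ⟨m, Q, hm, hQ, hroot⟩ := ih k (by omega) hk1 (taylor a R)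
    (fun j hj => by rw [hred, hklow j hj]) (by rwa [hred])
  -- The substitutions are undone in turn: translate by α, scale by t^u with t replaced by t^m,
  -- translate by h.
  refine ⟨m * v, fun t => t ^ (m * u) * (Q t + α) + h.1 (t ^ (m * v)), Nat.mul_pos hm hv,
    ((analyticAt_id.pow _).mul (hQ.add analyticAt_const)).add
      (analyticAt_comp_pow h.2 (Nat.mul_pos hm hv)), ?_⟩
  filter_upwards [hroot, (tendsto_pow_zero hm).eventually hPR] with t ht1 ht2
  have ht2' := ht2 (Q t + α)
  rw [eval₂_taylor_evalAt] at ht1 ht2'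
  rw [pow_mul, pow_mul, ht2']
  change eval₂ _ (Q t + α) R = 0 at ht1
  rw [ht1, mul_zero]

end PuiseuxODE

/-! ### Normal form of an analytic differential -/

namespace PuiseuxODE

theorem exists_analytic_primitive {g : ℂ → ℂ} (hg : AnalyticAt ℂ g 0) :
    ∃ G : ℂ → ℂ, AnalyticAt ℂ G 0 ∧ G 0 = 0 ∧ ∀ᶠ t in 𝓝 (0 : ℂ), HasDerivAt G (g t) t := by
  obtain ⟨r, hr, hball⟩ := Metric.eventually_nhds_iff_ball.mp
    (Complex.analyticAt_iff_eventually_differentiableAt.mp hg)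
  have hd : DifferentiableOn ℂ g (Metric.ball 0 r) := fun z hz =>
    (hball z hz).differentiableWithinAt
  obtain ⟨G, hG0, hG⟩ := hd.isExactOn_ball.with_val_at 0 0
  have hev : ∀ᶠ t in 𝓝 (0 : ℂ), HasDerivAt G (g t) t :=
    Metric.eventually_nhds_iff_ball.mpr ⟨r, hr, hG⟩
  refine ⟨G, ?_, hG0, hev⟩
  rw [Complex.analyticAt_iff_eventually_differentiableAt]
  exact hev.mono fun t ht => ht.differentiableAt

/-- Analytic `N`-th roots of nonvanishing functions. -/
theorem exists_analytic_nth_root {v : ℂ → ℂ} (hv : AnalyticAt ℂ v 0) (hv0 : v 0 ≠ 0) {N : ℕ}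
    (hN : 1 ≤ N) : ∃ w : ℂ → ℂ, AnalyticAt ℂ w 0 ∧ w 0 ≠ 0 ∧ ∀ t, w t ^ N = v t := by
  have hN0 : N ≠ 0 := by omega
  obtain ⟨c, hc⟩ := IsAlgClosed.exists_pow_nat_eq (v 0) hN
  have hc0 : c ≠ 0 := by
    rintro rfl
    exact hv0 (by rw [← hc, zero_pow hN0])
  -- Dividing by v 0 moves the base value to 1, where the principal power is analytic.
  refine ⟨fun t => c * (v t / v 0) ^ ((N : ℂ)⁻¹), ?_, ?_, fun t => ?_⟩
  · refine analyticAt_const.mul ((hv.div analyticAt_const hv0).cpow analyticAt_const ?_)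
    simp [div_self hv0]
  · simp [div_self hv0, hc0]
  · rw [mul_pow, Complex.cpow_nat_inv_pow _ hN0, hc, mul_div_cancel₀ _ hv0]

/-- The differential `g dt` becomes `d(s ^ N)` in a suitable coordinate `s`. -/
theorem exists_normalizing_coordinate {g : ℂ → ℂ} (hg : AnalyticAt ℂ g 0)
    (hne : ¬ ∀ᶠ t in 𝓝 (0 : ℂ), g t = 0) :
    ∃ (N : ℕ) (T : ℂ → ℂ), 1 ≤ N ∧ AnalyticAt ℂ T 0 ∧ T 0 = 0 ∧
      ∀ᶠ s in 𝓝 (0 : ℂ), g (T s) * deriv T s = N * s ^ (N - 1) := by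
  obtain ⟨G, hG, hG0, hGd⟩ := exists_analytic_primitive hg
  have hGne : ¬ ∀ᶠ t in 𝓝 (0 : ℂ), G t = 0 := by
    intro h
    refine hne ?_
    filter_upwards [h.eventually_nhds, hGd] with t h1 h2
    exact h2.unique ((hasDerivAt_const t (0 : ℂ)).congr_of_eventuallyEq h1)
  obtain ⟨N, v, hv, hv0, hGv⟩ := exists_eventually_eq_pow_mul hG hGne
  have hN : 1 ≤ N := by
    by_contra! h
    have h1 := hGv.self_of_nhds
    rw [hG0, (by omega : N = 0)] at h1
    exact hv0 (by simpa using h1.symm)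
  obtain ⟨w, hw, hw0, hwv⟩ := exists_analytic_nth_root hv hv0 hN
  have hψ : AnalyticAt ℂ (fun t => t * w t) 0 := analyticAt_id.mul hw
  have hψd : deriv (fun t => t * w t) 0 = w 0 := by
    -- Since G = (t w)^N near 0, the new coordinate is s = t w(t), and T is its local inverse.
    have := (hasDerivAt_id (0 : ℂ)).mul hw.differentiableAt.hasDerivAt
    simpa using! this.deriv
  have hψ' : deriv (fun t => t * w t) 0 ≠ 0 := by rwa [hψd]
  have hTa := hψ.analyticAt_localInverse hψ'
  have hT0 := HasStrictFDerivAt.localInverse_apply_image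
    (hψ.hasStrictDerivAt.hasStrictFDerivAt_equiv hψ')
  have hTr := hψ.hasStrictDerivAt.eventually_right_inverse hψ'
  set T := hψ.hasStrictDerivAt.localInverse _ _ _ hψ' with hT
  simp only [zero_mul] at hTa hT0 hTr
  refine ⟨N, T, hN, hTa, hT0, ?_⟩
  have hTt : Tendsto T (𝓝 0) (𝓝 0) := by
    have := hTa.continuousAt.tendsto
    rwa [show T 0 = 0 from hT0] at this
  have hGT : ∀ᶠ s in 𝓝 (0 : ℂ), G (T s) = s ^ N := by
    filter_upwards [hTr, hTt.eventually hGv] with s h1 h2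
    rw [h2, ← hwv, ← mul_pow, h1]
  filter_upwards [hGT.eventually_nhds, hTt.eventually hGd, hTa.eventually_analyticAt]
    with s h1 h2 h3
  exact (h2.comp s h3.differentiableAt.hasDerivAt).unique
    ((hasDerivAt_pow N s).congr_of_eventuallyEq h1)

end PuiseuxODE

/-! ### The curve F(y, 1/q) = 0 and the uniformized solution -/

namespace PuiseuxODE

/-- `F` as a polynomial in `p` with coefficients in `ℂ[y]`. -/
noncomputable def toBivariate : MvPolynomial (Fin 2) ℂ →ₐ[ℂ] Polynomial (Polynomial ℂ) :=
  MvPolynomial.aeval ![Polynomial.C Polynomial.X, Polynomial.X]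

theorem eval₂_toBivariate {R : Type*} [CommRing R] [Algebra ℂ R] (F : MvPolynomial (Fin 2) ℂ)
    (a b : R) :
    (toBivariate F).eval₂ (Polynomial.aeval a : Polynomial ℂ →ₐ[ℂ] R).toRingHom b =
      MvPolynomial.aeval ![a, b] F := by
  induction F using MvPolynomial.induction_on with
  | C c =>
    rw [← MvPolynomial.algebraMap_eq, AlgHom.commutes, AlgHom.commutes,
      IsScalarTower.algebraMap_apply ℂ (Polynomial ℂ) (Polynomial (Polynomial ℂ)),
      Polynomial.algebraMap_eq, Polynomial.eval₂_C]
    simp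
  | add p q hp hq => rw [map_add, Polynomial.eval₂_add, hp, hq, map_add]
  | mul_X p i hp =>
    rw [map_mul, Polynomial.eval₂_mul, hp, map_mul]
    congr 1
    fin_cases i <;> simp [toBivariate]

theorem eval_eq_eval₂_toBivariate (F : MvPolynomial (Fin 2) ℂ) (a b : ℂ) :
    MvPolynomial.eval ![a, b] F = (toBivariate F).eval₂ (Polynomial.evalRingHom a) b := by
  have h := eval₂_toBivariate F a b
  rw [MvPolynomial.aeval_eq_eval] at h
  rw [← h]
  congr 1

/-- An F of degree 0 in p is a polynomial in y dividing itself, hence a unit by hypothesis, hence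
constant. -/
theorem natDegree_toBivariate_pos {F : MvPolynomial (Fin 2) ℂ}
    (hF : ∀ c : ℂ, F ≠ MvPolynomial.C c) (hy : NoFactorIn F 0) :
    1 ≤ (toBivariate F).natDegree := by
  by_contra! h
  obtain ⟨g, hg⟩ := Polynomial.natDegree_eq_zero.mp (by omega : (toBivariate F).natDegree = 0)
  have h1 := eval₂_toBivariate F (MvPolynomial.X 0 : MvPolynomial (Fin 2) ℂ) (MvPolynomial.X 1)
  have h2 : MvPolynomial.aeval ![(MvPolynomial.X 0 : MvPolynomial (Fin 2) ℂ), MvPolynomial.X 1] F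
      = F := by
    have : ![(MvPolynomial.X 0 : MvPolynomial (Fin 2) ℂ), MvPolynomial.X 1] = MvPolynomial.X := by
      funext i
      fin_cases i <;> rfl
    rw [this, MvPolynomial.aeval_X_left_apply]
  rw [h2, ← hg, Polynomial.eval₂_C] at h1
  have h3 : Polynomial.aeval (MvPolynomial.X 0 : MvPolynomial (Fin 2) ℂ) g = F := h1
  obtain ⟨c, -, hc⟩ := Polynomial.isUnit_iff.mp (hy g (by rw [h3]))
  refine hF c ?_
  rw [← h3, ← hc, Polynomial.aeval_C, MvPolynomial.algebraMap_eq]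

/-- Translation `g ↦ g(y₀ + t)` into functions analytic at `0`. -/
noncomputable def translate (y₀ : ℂ) : Polynomial ℂ →+* analyticAtZero where
  toFun g := ⟨fun t => g.eval (y₀ + t), by
    have h : AnalyticAt ℂ (fun t : ℂ => y₀ + t) 0 := analyticAt_const.add analyticAt_id
    exact (h.aeval_polynomial g)⟩
  map_one' := by ext; simp
  map_mul' _ _ := by ext; simp
  map_zero' := by ext; simp
  map_add' _ _ := by ext; simp

theorem evalAt_comp_translate (y₀ t : ℂ) :
    (evalAt t).comp (translate y₀) = Polynomial.evalRingHom (y₀ + t) := rfl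

/-- If `F(y₀, 0) ≠ 0`, the curve `F(y, 1 / q) = 0` has an analytic branch over `y = y₀ + t ^ m`. -/
theorem exists_analytic_branch {F : MvPolynomial (Fin 2) ℂ}
    (hdeg : 1 ≤ (toBivariate F).natDegree) {y₀ : ℂ} (h0 : MvPolynomial.eval ![y₀, 0] F ≠ 0) :
    ∃ (m : ℕ) (Q : ℂ → ℂ), 1 ≤ m ∧ AnalyticAt ℂ Q 0 ∧ (¬ ∀ᶠ t in 𝓝 (0 : ℂ), Q t = 0) ∧
      ∀ᶠ t in 𝓝 (0 : ℂ), Q t ≠ 0 → MvPolynomial.eval ![y₀ + t ^ m, (Q t)⁻¹] F = 0 := by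
  set P := toBivariate F with hP
  have hP0 : P ≠ 0 := by
    rintro h
    rw [h] at hdeg
    simp at hdeg
  let R := P.reverse.map (translate y₀)
  let p := P.reverse.map (Polynomial.evalRingHom y₀)
  have hRp : R.map (evalAt 0) = p := by
    simp only [R, p, Polynomial.map_map, evalAt_comp_translate, add_zero]
  have hpd : p.coeff P.natDegree ≠ 0 := by
    simp only [p, Polynomial.coeff_map, Polynomial.coeff_reverse]
    rw [Polynomial.revAt_le le_rfl, Nat.sub_self]
    rw [eval_eq_eval₂_toBivariate, ← hP, Polynomial.eval₂_at_zero] at h0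
    exact h0
  have hp0 : p ≠ 0 := by
    intro h
    simp [h] at hpd
  -- The value α = 0 is allowed: it is the case of infinite slope p.
  obtain ⟨α, hα⟩ := Complex.exists_root (f := p) (Polynomial.natDegree_pos_iff_degree_pos.mp
    (lt_of_lt_of_le hdeg (Polynomial.le_natDegree_of_ne_zero hpd)))
  have ht : Polynomial.taylor α p ≠ 0 := by simpa using hp0
  let a : analyticAtZero := ⟨fun _ => α, analyticAt_const⟩
  have hred : ∀ j, ((Polynomial.taylor a R).coeff j).1 0 = (Polynomial.taylor α p).coeff j := by
    intro j
    have : (Polynomial.taylor a R).map (evalAt 0) = Polynomial.taylor α p := by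
      rw [← hRp]
      exact Polynomial.map_taylor ..
    rw [← this, Polynomial.coeff_map, evalAt_apply]
  obtain ⟨m, Q, hm, hQ, hroot⟩ := exists_analytic_puiseux_root
    (Polynomial.taylor α p).natTrailingDegree
    (by
      rw [Nat.one_le_iff_ne_zero, Ne, Polynomial.natTrailingDegree_eq_zero, not_or,
        Polynomial.taylor_coeff_zero]
      exact ⟨ht, fun h => h hα⟩) (Polynomial.taylor a R)
    (fun j hj => by rw [hred]; exact Polynomial.coeff_eq_zero_of_lt_natTrailingDegree hj)
    (by rw [hred]; exact Polynomial.trailingCoeff_nonzero_iff_nonzero.mpr ht)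
  have hroot' : ∀ᶠ t in 𝓝 (0 : ℂ),
      P.reverse.eval₂ (Polynomial.evalRingHom (y₀ + t ^ m)) (Q t + α) = 0 := by
    filter_upwards [hroot] with t h
    rw [eval₂_taylor_evalAt, Polynomial.eval₂_map, evalAt_comp_translate] at h
    exact h
  refine ⟨m, fun t => Q t + α, hm, hQ.add analyticAt_const, ?_, ?_⟩
  · intro hz
    -- If q vanished along the branch, the leading coefficient of F in p would vanish at all y₀ +
    -- t^m with t near 0, hence be zero.
    have hlead : ∀ᶠ t in 𝓝 (0 : ℂ), P.leadingCoeff.eval (y₀ + t ^ m) = 0 := by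
      filter_upwards [hroot', hz] with t h1 h2
      rw [h2, Polynomial.eval₂_at_zero, Polynomial.coeff_zero_reverse] at h1
      exact h1
    have hcomp : P.leadingCoeff.comp (Polynomial.C y₀ + Polynomial.X ^ m) = 0 := by
      refine Polynomial.eq_zero_of_infinite_isRoot _ ?_
      refine Set.Infinite.mono (s := {t : ℂ | P.leadingCoeff.eval (y₀ + t ^ m) = 0}) ?_ ?_
      · intro t ht
        simpa using ht
      · exact infinite_of_mem_nhds 0 hlead
    rw [Polynomial.comp_eq_zero_iff] at hcomp
    rcases hcomp with h | ⟨-, h⟩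
    · exact hP0 (Polynomial.leadingCoeff_eq_zero.mp h)
    · have := congrArg (fun q => Polynomial.coeff q m) h
      have hm' : m ≠ 0 := by omega
      simp [Polynomial.coeff_C, hm', hm'.symm] at this
  · filter_upwards [hroot'] with t h hne
    let _ : Invertible (Q t + α)⁻¹ := invertibleOfNonzero (inv_ne_zero hne)
    rw [eval_eq_eval₂_toBivariate, ← hP, ← Polynomial.eval₂_reverse_eq_zero_iff]
    simpa using h

/-- The local uniformized form of the theorem: `y = A(s)`, `x - x₀ = s ^ N`. -/
theorem exists_uniformized_solution {F : MvPolynomial (Fin 2) ℂ}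
    (hF : ∀ c : ℂ, F ≠ MvPolynomial.C c) (hy : NoFactorIn F 0) (y₀ : ℂ) :
    ∃ (N : ℕ) (A : ℂ → ℂ), 1 ≤ N ∧ AnalyticAt ℂ A 0 ∧ A 0 = y₀ ∧
      ∀ᶠ s in 𝓝[≠] (0 : ℂ), MvPolynomial.eval ![A s, deriv A s / (N * s ^ (N - 1))] F = 0 := by
  by_cases h0 : MvPolynomial.eval ![y₀, 0] F = 0
  · exact ⟨1, fun _ => y₀, le_rfl, analyticAt_const, rfl, Eventually.of_forall fun s => by simpa⟩
  obtain ⟨m, Q, hm, hQ, hQne, hQF⟩ := exists_analytic_branch (natDegree_toBivariate_pos hF hy) h0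
  have hg : AnalyticAt ℂ (fun t => m * t ^ (m - 1) * Q t) 0 :=
    (analyticAt_const.mul (analyticAt_id.pow _)).mul hQ
  have hm0 : (m : ℂ) ≠ 0 := by exact_mod_cast (by omega : m ≠ 0)
  have hgne : ¬ ∀ᶠ t in 𝓝 (0 : ℂ), m * t ^ (m - 1) * Q t = 0 := by
    intro h
    rcases hQ.eventually_eq_zero_or_eventually_ne_zero with h1 | h1
    · exact hQne h1
    · obtain ⟨t, ⟨h2, h3⟩, h4⟩ := (((h.filter_mono nhdsWithin_le_nhds).and h1).and
        self_mem_nhdsWithin).exists (f := 𝓝[≠] (0 : ℂ))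
      simp only [mul_eq_zero, hm0, h3, false_or, or_false] at h2
      exact h4 (eq_zero_of_pow_eq_zero h2)
  obtain ⟨N, T, hN, hT, hT0, hTN⟩ := exists_normalizing_coordinate hg hgne
  have hTt : Tendsto T (𝓝 0) (𝓝 0) := by
    have := hT.continuousAt.tendsto
    rwa [hT0] at this
  refine ⟨N, fun s => y₀ + T s ^ m, hN, analyticAt_const.add (hT.pow m),
    by simp [hT0, Nat.ne_of_gt hm], ?_⟩
  rw [eventually_nhdsWithin_iff]
  filter_upwards [hTN, hTt.eventually hQF, hT.eventually_analyticAt] with s h1 h2 h3 hs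
  have hN0 : (N : ℂ) * s ^ (N - 1) ≠ 0 :=
    mul_ne_zero (by exact_mod_cast (by omega : N ≠ 0)) (pow_ne_zero _ hs)
  have hd : deriv (fun s => y₀ + T s ^ m) s = m * T s ^ (m - 1) * deriv T s :=
    ((h3.differentiableAt.hasDerivAt.pow m).const_add y₀).deriv
  have hQ0 : Q (T s) ≠ 0 := by
    intro h
    rw [← h1, h] at hN0
    simp at hN0
  have hq : deriv (fun s => y₀ + T s ^ m) s / (N * s ^ (N - 1)) = (Q (T s))⁻¹ := by
    rw [div_eq_iff hN0, hd, ← h1]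
    field_simp
  simp only [hq]
  exact h2 hQ0

end PuiseuxODE

/-! ### From analytic identities to formal Puiseux series -/

namespace PuiseuxODE

/-- Clearing the denominator of `F(y, r / z)`. -/
theorem exists_homogenization (F : MvPolynomial (Fin 2) ℂ) :
    ∃ (D : ℕ) (H : MvPolynomial (Fin 3) ℂ), ∀ (R : Type) [CommRing R] [Algebra ℂ R] (y p z : R),
      z ^ D * MvPolynomial.aeval ![y, p] F = MvPolynomial.aeval ![y, p * z, z] H := by
  induction F using MvPolynomial.induction_on with
  | C c =>
    refine ⟨0, MvPolynomial.C c, fun R _ _ y p z => ?_⟩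
    rw [← MvPolynomial.algebraMap_eq, ← MvPolynomial.algebraMap_eq, AlgHom.commutes,
      AlgHom.commutes, pow_zero, one_mul]
  | add F G hF hG =>
    obtain ⟨D, H, h⟩ := hF
    obtain ⟨E, K, k⟩ := hG
    refine ⟨D + E, MvPolynomial.X 2 ^ E * H + MvPolynomial.X 2 ^ D * K, fun R _ _ y p z => ?_⟩
    simp only [map_add, map_mul, map_pow, MvPolynomial.aeval_X, ← h, ← k]
    simp only [Matrix.cons_val]
    ring
  | mul_X F i hF =>
    obtain ⟨D, H, h⟩ := hF
    fin_cases i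
    · refine ⟨D, H * MvPolynomial.X 0, fun R _ _ y p z => ?_⟩
      simp only [map_mul, MvPolynomial.aeval_X, ← h]
      simp
      ring
    · refine ⟨D + 1, H * MvPolynomial.X 1, fun R _ _ y p z => ?_⟩
      simp only [map_mul, MvPolynomial.aeval_X, ← h]
      simp
      ring

/-- `φ` is the Taylor expansion of `f` at `0`. -/
def IsTaylorSeries (φ : PowerSeries ℂ) (f : ℂ → ℂ) : Prop :=
  ∀ᶠ t in 𝓝 (0 : ℂ), HasSum (fun n => PowerSeries.coeff n φ * t ^ n) (f t)

namespace IsTaylorSeries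

variable {φ ψ : PowerSeries ℂ} {f g : ℂ → ℂ}

theorem C (c : ℂ) : IsTaylorSeries (PowerSeries.C c) fun _ => c := by
  refine Eventually.of_forall fun t => ?_
  convert hasSum_single (f := fun n => PowerSeries.coeff n (PowerSeries.C c) * t ^ n) 0 ?_ using 1
  · simp
  · intro n hn
    simp [PowerSeries.coeff_C, hn]

theorem X : IsTaylorSeries PowerSeries.X fun t => t := by
  refine Eventually.of_forall fun t => ?_
  convert hasSum_single (f := fun n => PowerSeries.coeff n PowerSeries.X * t ^ n) 1 ?_ using 1
  · simp
  · intro n hn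
    simp [PowerSeries.coeff_X, hn]

theorem add (hf : IsTaylorSeries φ f) (hg : IsTaylorSeries ψ g) :
    IsTaylorSeries (φ + ψ) fun t => f t + g t := by
  filter_upwards [hf, hg] with t h1 h2
  simpa [add_mul] using h1.add h2

theorem mul (hf : IsTaylorSeries φ f) (hg : IsTaylorSeries ψ g) :
    IsTaylorSeries (φ * ψ) fun t => f t * g t := by
  filter_upwards [hf, hg] with t h1 h2
  have s1 := h1.summable.norm
  have s2 := h2.summable.norm
  have h3 := (summable_norm_sum_mul_antidiagonal_of_summable_norm s1 s2).of_norm.hasSum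
  rw [← tsum_mul_tsum_eq_tsum_sum_antidiagonal_of_summable_norm s1 s2, h1.tsum_eq, h2.tsum_eq] at h3
  have h4 : ∀ n, PowerSeries.coeff n (φ * ψ) * t ^ n = ∑ kl ∈ Finset.HasAntidiagonal.antidiagonal n,
      PowerSeries.coeff kl.1 φ * t ^ kl.1 * (PowerSeries.coeff kl.2 ψ * t ^ kl.2) := by
    intro n
    rw [PowerSeries.coeff_mul, Finset.sum_mul]
    refine Finset.sum_congr rfl fun x hx => ?_
    rw [← Finset.HasAntidiagonal.mem_antidiagonal.mp hx, pow_add]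
    ring
  simpa only [h4] using h3

theorem aeval {ι : Type*} {Φ : ι → PowerSeries ℂ} {f : ι → ℂ → ℂ}
    (h : ∀ i, IsTaylorSeries (Φ i) (f i)) (H : MvPolynomial ι ℂ) :
    IsTaylorSeries (MvPolynomial.aeval Φ H) fun t => MvPolynomial.aeval (fun i => f i t) H := by
  induction H using MvPolynomial.induction_on with
  | C c => simpa using! C c
  | add p q hp hq => simpa only [map_add] using hp.add hq
  | mul_X p i hp => simpa only [map_mul, MvPolynomial.aeval_X] using hp.mul (h i)

/-- Uniqueness of power series expansions; it turns an identity between functions near 0 into one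
between formal series. -/
theorem eq_zero (hf : IsTaylorSeries φ f) (h0 : ∀ᶠ t in 𝓝 (0 : ℂ), f t = 0) : φ = 0 := by
  have hp : HasFPowerSeriesAt (0 : ℂ → ℂ)
      (FormalMultilinearSeries.ofScalars ℂ fun n => PowerSeries.coeff n φ) 0 := by
    rw [hasFPowerSeriesAt_iff]
    filter_upwards [hf, h0] with t h1 h2
    rw [h2] at h1
    simpa [mul_comm, FormalMultilinearSeries.coeff_ofScalars] using h1
  ext n
  have := congrArg (fun p => FormalMultilinearSeries.coeff p n) hp.eq_zero
  simpa [FormalMultilinearSeries.coeff_ofScalars] using! this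

end IsTaylorSeries

/-- The Taylor series at `0`. -/
noncomputable def taylorSeries (f : ℂ → ℂ) : PowerSeries ℂ :=
  PowerSeries.mk fun n => iteratedDeriv n f 0 / n.factorial

theorem isTaylorSeries_taylorSeries {f : ℂ → ℂ} (hf : AnalyticAt ℂ f 0) :
    IsTaylorSeries (taylorSeries f) f := by
  have := hasFPowerSeriesAt_iff.mp hf.hasFPowerSeriesAt
  filter_upwards [this] with t ht
  simpa [taylorSeries, mul_comm, FormalMultilinearSeries.coeff_ofScalars] using ht

theorem coeff_taylorSeries_deriv (f : ℂ → ℂ) (n : ℕ) :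
    PowerSeries.coeff n (taylorSeries (deriv f)) =
      (n + 1) * PowerSeries.coeff (n + 1) (taylorSeries f) := by
  simp only [taylorSeries, PowerSeries.coeff_mk, iteratedDeriv_succ', Nat.factorial_succ]
  have h1 : (n.factorial : ℂ) ≠ 0 := by exact_mod_cast n.factorial_ne_zero
  have h2 : (n : ℂ) + 1 ≠ 0 := Nat.cast_add_one_ne_zero n
  push_cast
  field_simp

/-- The exponent map `i ↦ i / N`. -/
noncomputable def exponentHom (N : ℕ) : ℕ →+ ℚ where
  toFun i := (i : ℚ) / N
  map_zero' := by simp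
  map_add' a b := by push_cast; ring

theorem exponentHom_le_iff {N : ℕ} (hN : 1 ≤ N) (a b : ℕ) :
    exponentHom N a ≤ exponentHom N b ↔ a ≤ b := by
  have : (0 : ℚ) < N := by exact_mod_cast hN
  change (a : ℚ) / N ≤ (b : ℚ) / N ↔ _
  rw [div_le_div_iff_of_pos_right this, Nat.cast_le]

theorem exponentHom_injective {N : ℕ} (hN : 1 ≤ N) : Function.Injective (exponentHom N) :=
  fun a b h => le_antisymm ((exponentHom_le_iff hN a b).mp h.le) ((exponentHom_le_iff hN b a).mp h.ge)

/-- The substitution `t = x ^ (1 / N)` of power series. -/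
noncomputable def puiseuxRingHom {N : ℕ} (hN : 1 ≤ N) : PowerSeries ℂ →+* HahnSeries ℚ ℂ :=
  (HahnSeries.embDomainRingHom (exponentHom N) (exponentHom_injective hN)
    (exponentHom_le_iff hN)).comp (HahnSeries.toPowerSeries (R := ℂ)).symm.toRingHom

theorem puiseuxRingHom_apply {N : ℕ} (hN : 1 ≤ N) (φ : PowerSeries ℂ) :
    puiseuxRingHom hN φ = HahnSeries.embDomain
      ⟨⟨exponentHom N, exponentHom_injective hN⟩, exponentHom_le_iff hN _ _⟩
      (HahnSeries.toPowerSeries.symm φ) := rfl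

theorem coeff_puiseuxRingHom {N : ℕ} (hN : 1 ≤ N) (φ : PowerSeries ℂ) (i : ℕ) :
    (puiseuxRingHom hN φ).coeff ((i : ℚ) / N) = PowerSeries.coeff i φ := by
  rw [puiseuxRingHom_apply]
  exact HahnSeries.embDomain_coeff (a := i)

theorem coeff_puiseuxRingHom_of_notMem {N : ℕ} (hN : 1 ≤ N) (φ : PowerSeries ℂ) {q : ℚ}
    (hq : ∀ i : ℕ, q ≠ (i : ℚ) / N) : (puiseuxRingHom hN φ).coeff q = 0 := by
  rw [puiseuxRingHom_apply]
  refine HahnSeries.embDomain_of_notMem_range ?_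
  rintro ⟨i, rfl⟩
  exact hq i rfl

theorem puiseuxRingHom_C {N : ℕ} (hN : 1 ≤ N) (c : ℂ) :
    puiseuxRingHom hN (PowerSeries.C c) = HahnSeries.C c := by
  have hN0 : (N : ℚ) ≠ 0 := by exact_mod_cast (by omega : N ≠ 0)
  ext q
  by_cases hq : ∃ i : ℕ, q = (i : ℚ) / N
  · obtain ⟨i, rfl⟩ := hq
    rw [coeff_puiseuxRingHom, PowerSeries.coeff_C, HahnSeries.C_apply, HahnSeries.coeff_single]
    simp [hN0]
  · push Not at hq
    rw [coeff_puiseuxRingHom_of_notMem hN _ hq, HahnSeries.C_apply,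
      HahnSeries.coeff_single_of_ne (by simpa using hq 0)]

/-- `puiseuxRingHom` as an algebra homomorphism. -/
noncomputable def puiseuxHom {N : ℕ} (hN : 1 ≤ N) : PowerSeries ℂ →ₐ[ℂ] HahnSeries ℚ ℂ :=
  { puiseuxRingHom hN with
    commutes' := fun c => by
      rw [HahnSeries.algebraMap_apply']
      change puiseuxRingHom hN (PowerSeries.C c) = HahnSeries.ofPowerSeries ℚ ℂ (PowerSeries.C c)
      rw [puiseuxRingHom_C, HahnSeries.ofPowerSeries_C] }

theorem coeff_puiseuxHom {N : ℕ} (hN : 1 ≤ N) (φ : PowerSeries ℂ) (i : ℕ) :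
    (puiseuxHom hN φ).coeff ((i : ℚ) / N) = PowerSeries.coeff i φ :=
  coeff_puiseuxRingHom hN φ i

theorem coeff_puiseuxHom_of_notMem {N : ℕ} (hN : 1 ≤ N) (φ : PowerSeries ℂ) {q : ℚ}
    (hq : ∀ i : ℕ, q ≠ (i : ℚ) / N) : (puiseuxHom hN φ).coeff q = 0 :=
  coeff_puiseuxRingHom_of_notMem hN φ hq

theorem puiseuxHom_X_pow {N : ℕ} (hN : 1 ≤ N) (k : ℕ) :
    puiseuxHom hN (PowerSeries.X ^ k) = HahnSeries.single ((k : ℚ) / N) 1 := by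
  have hN0 : (N : ℚ) ≠ 0 := by exact_mod_cast (by omega : N ≠ 0)
  ext q
  by_cases hq : ∃ i : ℕ, q = (i : ℚ) / N
  · obtain ⟨i, rfl⟩ := hq
    rw [coeff_puiseuxHom, PowerSeries.coeff_X_pow, HahnSeries.coeff_single]
    simp [div_left_inj' hN0]
  · push Not at hq
    rw [coeff_puiseuxHom_of_notMem hN _ hq, HahnSeries.coeff_single_of_ne (hq k)]

/-- The chain rule `N x ^ ((N - 1) / N) dy/dx = dy/dt` for `x = t ^ N`. -/
theorem formalDeriv_puiseuxHom {N : ℕ} (hN : 1 ≤ N) (f : ℂ → ℂ) :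
    formalDeriv (puiseuxHom hN (taylorSeries f)) *
        puiseuxHom hN (PowerSeries.C (N : ℂ) * PowerSeries.X ^ (N - 1)) =
      puiseuxHom hN (taylorSeries (deriv f)) := by
  have hN0 : (N : ℚ) ≠ 0 := by exact_mod_cast (by omega : N ≠ 0)
  have hNC : (N : ℂ) ≠ 0 := by exact_mod_cast (by omega : N ≠ 0)
  have hz : puiseuxHom hN (PowerSeries.C (N : ℂ) * PowerSeries.X ^ (N - 1)) =
      HahnSeries.single (((N - 1 : ℕ) : ℚ) / N) (N : ℂ) := by
    have hC : puiseuxHom hN (PowerSeries.C (N : ℂ)) = HahnSeries.C (N : ℂ) :=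
      puiseuxRingHom_C hN N
    rw [map_mul, hC, puiseuxHom_X_pow, HahnSeries.C_apply, HahnSeries.single_mul_single,
      zero_add, mul_one]
  ext q
  rw [hz, HahnSeries.coeff_mul_single]
  have hq1 : q - ((N - 1 : ℕ) : ℚ) / N + 1 = q + 1 / N := by
    rw [Nat.cast_sub hN]
    field_simp
    push_cast
    ring
  change ((_ : ℚ) : ℂ) * _ * _ = _
  rw [hq1]
  by_cases hq : ∃ i : ℕ, q = (i : ℚ) / N
  · obtain ⟨i, rfl⟩ := hq
    have : (i : ℚ) / N + 1 / N = ((i + 1 : ℕ) : ℚ) / N := by push_cast; ring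
    rw [this, coeff_puiseuxHom, coeff_puiseuxHom, coeff_taylorSeries_deriv]
    push_cast
    field_simp
  · push Not at hq
    rw [coeff_puiseuxHom_of_notMem hN _ hq]
    -- Outside (1/N)ℕ the only possible contribution is at q + 1/N = 0, the constant term, which is
    -- killed by the exponent factor of the derivative.
    by_cases hj : ∃ j : ℕ, q + 1 / N = (j : ℚ) / N
    · obtain ⟨j, hj⟩ := hj
      rcases j with _ | j
      · rw [hj]
        simp
      · refine absurd ?_ (hq j)
        rw [eq_sub_of_add_eq hj]
        push_cast
        ring
    · push Not at hj
      rw [coeff_puiseuxHom_of_notMem hN _ hj]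
      simp

theorem puiseuxHom_injective {N : ℕ} (hN : 1 ≤ N) : Function.Injective (puiseuxHom hN) := by
  intro φ ψ h
  ext i
  rw [← coeff_puiseuxHom hN, h, coeff_puiseuxHom]

/-- The homogenized identity passes to Taylor series, then through `puiseuxHom` by the chain rule.
The factor (N x^((N-1)/N))^D is nonzero and cancels, Hahn series over ℚ forming a domain. -/
theorem isFormalSolution_puiseuxHom {N : ℕ} (hN : 1 ≤ N) {A : ℂ → ℂ} (hA : AnalyticAt ℂ A 0)
    {F : MvPolynomial (Fin 2) ℂ} {D : ℕ} {H : MvPolynomial (Fin 3) ℂ}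
    (hH : ∀ (R : Type) [CommRing R] [Algebra ℂ R] (y p z : R),
      z ^ D * MvPolynomial.aeval ![y, p] F = MvPolynomial.aeval ![y, p * z, z] H)
    (hs : ∀ᶠ s in 𝓝 (0 : ℂ), MvPolynomial.aeval ![A s, deriv A s, N * s ^ (N - 1)] H = 0) :
    IsFormalSolution F (puiseuxHom hN (taylorSeries A)) := by
  have hpow : ∀ k : ℕ, IsTaylorSeries (PowerSeries.X ^ k) fun s => s ^ k := by
    intro k
    induction k with
    | zero => simpa using! IsTaylorSeries.C 1
    | succ k ih => simpa only [pow_succ] using ih.mul IsTaylorSeries.X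
  have hz := (IsTaylorSeries.C (N : ℂ)).mul (hpow (N - 1))
  set Z : PowerSeries ℂ := PowerSeries.C (N : ℂ) * PowerSeries.X ^ (N - 1) with hZ
  have hser : MvPolynomial.aeval ![taylorSeries A, taylorSeries (deriv A), Z] H = 0 := by
    refine IsTaylorSeries.eq_zero (IsTaylorSeries.aeval
      (f := ![A, deriv A, fun s => N * s ^ (N - 1)]) (fun i => ?_) H) ?_
    · fin_cases i
      · exact isTaylorSeries_taylorSeries hA
      · exact isTaylorSeries_taylorSeries hA.deriv
      · exact hz
    · filter_upwards [hs] with s h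
      rw [← h]
      congr 2
      funext i
      fin_cases i <;> rfl
  have himg : MvPolynomial.aeval ![puiseuxHom hN (taylorSeries A),
      formalDeriv (puiseuxHom hN (taylorSeries A)) * puiseuxHom hN Z, puiseuxHom hN Z] H = 0 := by
    rw [formalDeriv_puiseuxHom, ← map_zero (puiseuxHom hN), ← hser, ← AlgHom.comp_apply,
      MvPolynomial.comp_aeval]
    congr 2
    funext i
    fin_cases i <;> rfl
  rw [← hH] at himg
  refine (mul_eq_zero.mp himg).resolve_left (pow_ne_zero _ ?_)
  rw [Ne, map_eq_zero_iff _ (puiseuxHom_injective hN)]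
  refine mul_ne_zero ?_ (pow_ne_zero _ PowerSeries.X_ne_zero)
  rw [Ne, map_eq_zero_iff _ PowerSeries.C_injective]
  exact_mod_cast (by omega : N ≠ 0)

end PuiseuxODE

/-! ### Convergence and holomorphic branches -/

namespace PuiseuxODE

theorem coeff_puiseuxHom_of_neg {N : ℕ} (hN : 1 ≤ N) (φ : PowerSeries ℂ) {j : ℤ} (hj : j < 0) :
    (puiseuxHom hN φ).coeff ((j : ℚ) / N) = 0 := by
  have hN0 : (N : ℚ) ≠ 0 := by exact_mod_cast (by omega : N ≠ 0)
  refine coeff_puiseuxHom_of_notMem hN φ fun i hi => ?_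
  rw [div_left_inj' hN0] at hi
  have : j = i := by exact_mod_cast hi
  omega

/-- There are no negative exponents, so the sum over ℤ reduces to one over ℕ. The point t = 0 is
included, which gives the value at x₀. -/
theorem hasSum_puiseuxHom {N : ℕ} (hN : 1 ≤ N) {φ : PowerSeries ℂ} {t a : ℂ}
    (h : HasSum (fun n => PowerSeries.coeff n φ * t ^ n) a) :
    HasSum (fun j : ℤ => (puiseuxHom hN φ).coeff ((j : ℚ) / N) * t ^ j) a := by
  rw [← (Nat.cast_injective (R := ℤ)).hasSum_iff]
  · convert h using 2 with n
    simp [coeff_puiseuxHom]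
  · intro j hj
    have : j < 0 := by
      by_contra! h0
      exact hj ⟨j.toNat, by simpa using h0⟩
    rw [coeff_puiseuxHom_of_neg hN φ this, zero_mul]

/-- The identity principle extends the equation from s ≠ 0 to s = 0. That point matters when N = 1,
since U may then contain x₀. -/
theorem eventually_homogenization_eq_zero {F : MvPolynomial (Fin 2) ℂ} {D : ℕ}
    {H : MvPolynomial (Fin 3) ℂ}
    (hH : ∀ (R : Type) [CommRing R] [Algebra ℂ R] (y p z : R),
      z ^ D * MvPolynomial.aeval ![y, p] F = MvPolynomial.aeval ![y, p * z, z] H)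
    {N : ℕ} (hN : 1 ≤ N) {A : ℂ → ℂ} (hA : AnalyticAt ℂ A 0)
    (hF : ∀ᶠ s in 𝓝[≠] (0 : ℂ), MvPolynomial.eval ![A s, deriv A s / (N * s ^ (N - 1))] F = 0) :
    ∀ᶠ s in 𝓝 (0 : ℂ), MvPolynomial.aeval ![A s, deriv A s, N * s ^ (N - 1)] H = 0 := by
  have han : AnalyticAt ℂ
      (fun s => MvPolynomial.aeval ![A s, deriv A s, N * s ^ (N - 1)] H) 0 := by
    refine AnalyticAt.aeval_mvPolynomial (fun i => ?_) H
    fin_cases i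
    · exact hA
    · exact hA.deriv
    · exact analyticAt_const.mul (analyticAt_id.pow _)
  refine han.frequently_zero_iff_eventually_zero.mp (Eventually.frequently ?_)
  filter_upwards [hF, self_mem_nhdsWithin] with s h hs
  have hz : (N : ℂ) * s ^ (N - 1) ≠ 0 :=
    mul_ne_zero (by exact_mod_cast (by omega : N ≠ 0)) (pow_ne_zero _ hs)
  have := hH ℂ (A s) (deriv A s / (N * s ^ (N - 1))) (N * s ^ (N - 1))
  rw [div_mul_cancel₀ _ hz, MvPolynomial.aeval_eq_eval, h, mul_zero] at this
  exact this.symm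

end PuiseuxODE

theorem mainTheorem2 (F : MvPolynomial (Fin 2) ℂ)
    (hF : ∀ c : ℂ, F ≠ MvPolynomial.C c)
    (hy : NoFactorIn F 0) (hp : NoFactorIn F 1) (x₀ y₀ : ℂ) :
    ∃ (φ : HahnSeries ℚ ℂ) (n : ℕ) (ρ : ℝ),
      HasDenominator φ n ∧ IsFormalSolution F φ ∧ HasInitialValue φ y₀ ∧
      0 < ρ ∧ ConvergesOn φ n ρ ∧
      -- every branch of the sum of `φ` in powers of `(x - x₀)^(1/n)` is a holomorphic solution
      (∀ (U : Set ℂ) (s : ℂ → ℂ), IsOpen U → U ⊆ Metric.ball x₀ (ρ ^ n) →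
        DifferentiableOn ℂ s U → (∀ x ∈ U, s x ^ n = x - x₀) →
        IsSolutionOn F U fun x => puiseuxSum φ n (s x)) ∧
      -- and `y(x₀) = y₀`, attained continuously
      (∀ s : ℂ → ℂ, (∀ᶠ x in 𝓝 x₀, s x ^ n = x - x₀) →
        puiseuxSum φ n (s x₀) = y₀ ∧
        Tendsto (fun x => puiseuxSum φ n (s x)) (𝓝 x₀) (𝓝 y₀)) := by
  obtain ⟨N, A, hN, hA, hA0, hsol⟩ := exists_uniformized_solution hF hy y₀
  obtain ⟨D, H, hH⟩ := exists_homogenization F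
  have hHz := eventually_homogenization_eq_zero hH hN hA hsol
  have htay := isTaylorSeries_taylorSeries hA
  -- On one disc the Taylor series converges to A, the homogenized equation holds and A is analytic.
  obtain ⟨ρ, hρ, hball⟩ := Metric.eventually_nhds_iff_ball.mp
    ((htay.and hHz).and hA.eventually_analyticAt)
  have hsum : ∀ t ∈ Metric.ball (0 : ℂ) ρ,
      puiseuxSum (puiseuxHom hN (taylorSeries A)) N t = A t := fun t ht =>
    (hasSum_puiseuxHom hN (hball t ht).1.1).tsum_eq
  refine ⟨puiseuxHom hN (taylorSeries A), N, ρ, ⟨hN, fun q hq => ?_⟩,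
    isFormalSolution_puiseuxHom hN hA hH hHz, ⟨fun q hq => ?_, ?_⟩, hρ, fun t _ ht => ?_,
    fun U s hU hUρ hs hsN => ?_, fun s hs => ?_⟩
  · by_contra! h
    exact hq (coeff_puiseuxHom_of_notMem hN _ fun i => by simpa using h i)
  · refine coeff_puiseuxHom_of_notMem hN _ fun i hi => ?_
    rw [hi] at hq
    exact absurd hq (not_lt.mpr (by positivity))
  · have := coeff_puiseuxHom hN (taylorSeries A) 0
    simpa [taylorSeries, hA0] using this
  · exact (hasSum_puiseuxHom hN (hball t (by simpa using ht)).1.1).summable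
  · have hmem : ∀ x ∈ U, s x ∈ Metric.ball (0 : ℂ) ρ := by
      intro x hx
      have h1 := hUρ hx
      rw [mem_ball_iff_norm, ← hsN x hx, norm_pow] at h1
      simpa using lt_of_pow_lt_pow_left₀ N hρ.le h1
    have hderiv : ∀ x ∈ U, HasDerivAt (fun x => puiseuxSum (puiseuxHom hN (taylorSeries A)) N (s x))
        (deriv A (s x) * deriv s x) x := by
      intro x hx
      have hsx := (hs.differentiableAt (hU.mem_nhds hx)).hasDerivAt
      refine ((hball _ (hmem x hx)).2.differentiableAt.hasDerivAt.comp x hsx).congr_of_eventuallyEq ?_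
      filter_upwards [hU.mem_nhds hx] with z hz using hsum _ (hmem z hz)
    refine ⟨fun x hx => (hderiv x hx).differentiableAt.differentiableWithinAt, fun x hx => ?_⟩
    have hsx := (hs.differentiableAt (hU.mem_nhds hx)).hasDerivAt
    -- Differentiating s^N = x - x₀ shows that N s^(N-1) is nonzero on U with inverse s', so the
    -- homogenization can be undone at every point of U.
    have hone : N * s x ^ (N - 1) * deriv s x = 1 := by
      refine (hsx.pow N).unique (((hasDerivAt_id x).sub_const x₀).congr_of_eventuallyEq ?_)
      filter_upwards [hU.mem_nhds hx] with z hz using hsN z hz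
    have hz : (N : ℂ) * s x ^ (N - 1) ≠ 0 := left_ne_zero_of_mul_eq_one hone
    have hhom := hH ℂ (A (s x)) (deriv A (s x) * deriv s x) (N * s x ^ (N - 1))
    rw [mul_assoc (deriv A (s x)), mul_comm (deriv s x), hone, mul_one,
      (hball _ (hmem x hx)).1.2, MvPolynomial.aeval_eq_eval] at hhom
    rw [(hderiv x hx).deriv]
    beta_reduce
    rw [hsum _ (hmem x hx)]
    exact (mul_eq_zero.mp hhom).resolve_left (pow_ne_zero _ hz)
  · have hs0 : s x₀ = 0 := by
      have := hs.self_of_nhds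
      rw [sub_self] at this
      exact eq_zero_of_pow_eq_zero this
    have hst : Tendsto s (𝓝 x₀) (𝓝 0) := by
      rw [Metric.tendsto_nhds]
      intro ε hε
      filter_upwards [hs, Metric.ball_mem_nhds x₀ (pow_pos hε N)] with x h1 h2
      rw [mem_ball_iff_norm, ← h1, norm_pow] at h2
      simpa using lt_of_pow_lt_pow_left₀ N hε.le h2
    have hA' : Tendsto (fun x => A (s x)) (𝓝 x₀) (𝓝 y₀) := by
      have := hA.continuousAt.tendsto
      rw [hA0] at this
      exact this.comp hst
    refine ⟨by rw [hs0, hsum 0 (Metric.mem_ball_self hρ), hA0], hA'.congr' ?_⟩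
    filter_upwards [hst.eventually (Metric.ball_mem_nhds 0 hρ)] with x hx
    exact (hsum _ hx).symm
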